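/- An \emph{mpM-algebra} (modal pseudocomplemented De Morgan algebra) is a bounded distributive lattice $A$ with two unary operations $\sim$ and ${}^{*}$ such that, for all $a,x,y\in A$: $\sim\sim x=x$; $\sim(x\vee y)=\sim x\,\wedge\sim y$; $a\wedge x=0$ if and only if $x\le a^{*}$; and $x\,\vee\sim x\le x\vee x^{*}$. Let $k\ge 1$. A \emph{$\mathcal C_k$-algebra} is a pair $(A,t)$ where $A$ is an mpM-algebra and $t:A\to A$ is an automorphism of $A$ with $t^k(x)=x$ for all $x$; homomorphisms preserve $\wedge,\vee,\sim,{}^{*},0,1$ and $t$. For a positive integer $d$ let $M(d)$ be the set of divisors of $d$ different from $d$ that are maximal (for divisibility) among the divisors of $d$ different from $d$. For $H\subseteq M(d)\times M(d)$ let $H_1$ and $H_2$ be its projections to the first and the second coordinate. \textbf{Theorem.} Let $F_{\mathcal C_k}(n)$ be the free $\mathcal C_k$-algebra with $n$ generators. Then $F_{\mathcal C_k}(n)$ is finite and $$|F_{\mathcal C_k}(n)|=\prod_{d\mid k}(2^{d})^{\alpha_{2,d}}\cdot\prod_{d\mid k}(3^{d})^{\alpha_{3,d}}\cdot\prod_{d\mid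 k}(4^{d})^{\alpha_{4,d}},$$ where the exponents are the rational numbers $$\alpha_{2,d}=\frac{(2^d)^n-\sum_{\emptyset\ne Z\subseteq M(d)}(-1)^{|Z|-1}(2^{\gcd(Z)})^n}{d},$$ $$\alpha_{3,d}=\frac{(3^d)^n-(2^d)^n-\sum_{\emptyset\ne W\subseteq M(d)}(-1)^{|W|-1}(3^{\gcd(W)})^n+\sum_{\emptyset\ne H\subseteq M(d)\times M(d)}(-1)^{|H|-1}(2^{\gcd(H_1\cup H_2)})^n}{d},$$ $$\alpha_{4,d}=\frac{(4^d)^n-\sum_{\emptyset\ne W\subseteq M(d)}(-1)^{|W|-1}(4^{\gcd(W)})^n-(2^d)^n+\sum_{\emptyset\ne H\subseteq M(d)\times M(d)}(-1)^{|H|-1}(2^{\gcd(H_1\cup H_2)})^n}{2d}.$$ -/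

import Mathlib

/-- A modal pseudocomplemented De Morgan algebra (mpM-algebra): a bounded distributive lattice
with a De Morgan negation `dm` (written `∼`) and a pseudocomplement `pc` (written `*`) such that
`x ⊔ ∼x ≤ x ⊔ x*`. -/
class MpMAlgebra (A : Type*) extends DistribLattice A, BoundedOrder A where
  /-- the De Morgan negation `∼` -/
  dm : A → A
  /-- the pseudocomplement `*` -/
  pc : A → A
  dm_dm : ∀ x : A, dm (dm x) = x
  dm_sup : ∀ x y : A, dm (x ⊔ y) = dm x ⊓ dm y
  inf_eq_bot_iff : ∀ a x : A, a ⊓ x = ⊥ ↔ x ≤ pc a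
  tm : ∀ x : A, x ⊔ dm x ≤ x ⊔ pc x

/-- `f` is a homomorphism of mpM-algebras. -/
structure IsMpMHom {A B : Type*} [MpMAlgebra A] [MpMAlgebra B] (f : A → B) : Prop where
  map_bot : f ⊥ = ⊥
  map_top : f ⊤ = ⊤
  map_inf : ∀ x y, f (x ⊓ y) = f x ⊓ f y
  map_sup : ∀ x y, f (x ⊔ y) = f x ⊔ f y
  map_dm : ∀ x, f (MpMAlgebra.dm x) = MpMAlgebra.dm (f x)
  map_pc : ∀ x, f (MpMAlgebra.pc x) = MpMAlgebra.pc (f x)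

/-- A `k`-cyclic mpM-algebra (`C_k`-algebra): an mpM-algebra with an automorphism `t` such that
`t^k` is the identity. -/
class CkAlgebra (k : ℕ) (A : Type*) extends MpMAlgebra A where
  /-- the automorphism -/
  t : A → A
  t_hom : IsMpMHom t
  t_bijective : Function.Bijective t
  t_iterate : ∀ x : A, t^[k] x = x

/-- `f` is a homomorphism of `C_k`-algebras. -/
structure IsCkHom (k : ℕ) {A B : Type*} [CkAlgebra k A] [CkAlgebra k B] (f : A → B) : Prop
    extends IsMpMHom f where
  map_t : ∀ x, f (CkAlgebra.t k x) = CkAlgebra.t k (f x)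

/-- Terms in the language of `C_k`-algebras with variables from `X`. -/
inductive CkTerm (X : Type*) where
  | var : X → CkTerm X
  | bot : CkTerm X
  | top : CkTerm X
  | inf : CkTerm X → CkTerm X → CkTerm X
  | sup : CkTerm X → CkTerm X → CkTerm X
  | dm : CkTerm X → CkTerm X
  | pc : CkTerm X → CkTerm X
  | t : CkTerm X → CkTerm X

namespace CkTerm

/-- The least congruence on terms whose quotient satisfies the laws of `C_k`-algebras
(`x ≤ y` is expressed as `x ⊓ y = x`). -/
inductive Eqv (k : ℕ) {X : Type*} : CkTerm X → CkTerm X → Prop where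
  | refl (x) : Eqv k x x
  | symm {x y} : Eqv k x y → Eqv k y x
  | trans {x y z} : Eqv k x y → Eqv k y z → Eqv k x z
  | congr_inf {x x' y y'} : Eqv k x x' → Eqv k y y' → Eqv k (inf x y) (inf x' y')
  | congr_sup {x x' y y'} : Eqv k x x' → Eqv k y y' → Eqv k (sup x y) (sup x' y')
  | congr_dm {x x'} : Eqv k x x' → Eqv k (dm x) (dm x')
  | congr_pc {x x'} : Eqv k x x' → Eqv k (pc x) (pc x')
  | congr_t {x x'} : Eqv k x x' → Eqv k (t x) (t x')
  | inf_comm (x y) : Eqv k (inf x y) (inf y x)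
  | inf_assoc (x y z) : Eqv k (inf (inf x y) z) (inf x (inf y z))
  | sup_comm (x y) : Eqv k (sup x y) (sup y x)
  | sup_assoc (x y z) : Eqv k (sup (sup x y) z) (sup x (sup y z))
  | sup_inf_self (x y) : Eqv k (sup x (inf x y)) x
  | inf_sup_self (x y) : Eqv k (inf x (sup x y)) x
  | distrib (x y z) : Eqv k (inf (sup x y) (sup x z)) (sup x (inf y z))
  | bot_inf (x) : Eqv k (inf bot x) bot
  | inf_top (x) : Eqv k (inf x top) x
  | dm_dm (x) : Eqv k (dm (dm x)) x
  | dm_sup (x y) : Eqv k (dm (sup x y)) (inf (dm x) (dm y))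
  | le_pc {a x} : Eqv k (inf a x) bot → Eqv k (inf x (pc a)) x
  | inf_pc {a x} : Eqv k (inf x (pc a)) x → Eqv k (inf a x) bot
  | tm (x) : Eqv k (inf (sup x (dm x)) (sup x (pc x))) (sup x (dm x))
  | t_bot : Eqv k (t bot) bot
  | t_top : Eqv k (t top) top
  | t_inf (x y) : Eqv k (t (inf x y)) (inf (t x) (t y))
  | t_sup (x y) : Eqv k (t (sup x y)) (sup (t x) (t y))
  | t_dm (x) : Eqv k (t (dm x)) (dm (t x))
  | t_pc (x) : Eqv k (t (pc x)) (pc (t x))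
  | t_iterate (x) : Eqv k (t^[k] x) x

/-- The congruence `Eqv` as a setoid. -/
def eqvSetoid (k : ℕ) (X : Type*) : Setoid (CkTerm X) :=
  ⟨Eqv k, Eqv.refl, Eqv.symm, Eqv.trans⟩

/-- The value of a term in a `C_k`-algebra. -/
def eval (k : ℕ) {X A : Type*} [CkAlgebra k A] (v : X → A) : CkTerm X → A
  | var i => v i
  | bot => ⊥
  | top => ⊤
  | inf x y => eval k v x ⊓ eval k v y
  | sup x y => eval k v x ⊔ eval k v y
  | dm x => MpMAlgebra.dm (eval k v x)
  | pc x => MpMAlgebra.pc (eval k v x)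
  | t x => CkAlgebra.t k (eval k v x)

theorem eval_iterate (k : ℕ) {X A : Type*} [CkAlgebra k A] (v : X → A) (m : ℕ) (x : CkTerm X) :
    eval k v (t^[m] x) = (CkAlgebra.t k)^[m] (eval k v x) := by
  induction m generalizing x with
  | zero => rfl
  | succ m ih => rw [Function.iterate_succ_apply, Function.iterate_succ_apply, ih]; rfl

theorem eval_eq_of_eqv (k : ℕ) {X A : Type*} [CkAlgebra k A] (v : X → A) {x y : CkTerm X}
    (h : Eqv k x y) : eval k v x = eval k v y := by
  have ht : IsMpMHom (CkAlgebra.t k : A → A) := CkAlgebra.t_hom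
  induction h with
  | refl x => rfl
  | symm _ ih => exact ih.symm
  | trans _ _ ih1 ih2 => exact ih1.trans ih2
  | congr_inf _ _ ih1 ih2 => simp only [eval, ih1, ih2]
  | congr_sup _ _ ih1 ih2 => simp only [eval, ih1, ih2]
  | congr_dm _ ih => simp only [eval, ih]
  | congr_pc _ ih => simp only [eval, ih]
  | congr_t _ ih => simp only [eval, ih]
  | inf_comm x y => exact _root_.inf_comm _ _
  | inf_assoc x y z => exact _root_.inf_assoc _ _ _
  | sup_comm x y => exact _root_.sup_comm _ _
  | sup_assoc x y z => exact _root_.sup_assoc _ _ _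
  | sup_inf_self x y => exact _root_.sup_inf_self
  | inf_sup_self x y => exact _root_.inf_sup_self
  | distrib x y z => exact (sup_inf_left _ _ _).symm
  | bot_inf x => exact bot_inf_eq _
  | inf_top x => exact inf_top_eq _
  | dm_dm x => exact MpMAlgebra.dm_dm _
  | dm_sup x y => exact MpMAlgebra.dm_sup _ _
  | le_pc _ ih => exact inf_eq_left.2 ((MpMAlgebra.inf_eq_bot_iff _ _).1 ih)
  | inf_pc _ ih => exact (MpMAlgebra.inf_eq_bot_iff _ _).2 (inf_eq_left.1 ih)
  | tm x => exact inf_eq_left.2 (MpMAlgebra.tm _)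
  | t_bot => exact ht.map_bot
  | t_top => exact ht.map_top
  | t_inf x y => exact ht.map_inf _ _
  | t_sup x y => exact ht.map_sup _ _
  | t_dm x => exact ht.map_dm _
  | t_pc x => exact ht.map_pc _
  | t_iterate x => rw [eval_iterate]; exact CkAlgebra.t_iterate _

end CkTerm

/-- The free `C_k`-algebra `F_{C_k}(X)` on the set `X` of generators. -/
def FreeCk (k : ℕ) (X : Type*) : Type _ := Quotient (CkTerm.eqvSetoid k X)

namespace FreeCk

variable {k : ℕ} {X : Type*}

/-- The class of a term. -/
def mk (x : CkTerm X) : FreeCk k X := Quotient.mk (CkTerm.eqvSetoid k X) x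

/-- The generators. -/
def of (i : X) : FreeCk k X := mk (CkTerm.var i)

theorem mk_eq {x y : CkTerm X} : (mk x : FreeCk k X) = mk y ↔ CkTerm.Eqv k x y :=
  ⟨fun h => Quotient.exact h, fun h => Quotient.sound h⟩

theorem ind {p : FreeCk k X → Prop} (h : ∀ x, p (mk x)) (x : FreeCk k X) : p x :=
  Quotient.ind h x

instance instMax : Max (FreeCk k X) :=
  ⟨Quotient.map₂ CkTerm.sup fun _ _ h _ _ h' => CkTerm.Eqv.congr_sup h h'⟩

instance instMin : Min (FreeCk k X) :=
  ⟨Quotient.map₂ CkTerm.inf fun _ _ h _ _ h' => CkTerm.Eqv.congr_inf h h'⟩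

/-- The lattice order on the free algebra is `x ≤ y ↔ x ⊔ y = y`. -/
instance instLattice : Lattice (FreeCk k X) :=
  Lattice.mk'
    (ind fun x => ind fun y => mk_eq.2 (.sup_comm x y))
    (ind fun x => ind fun y => ind fun z => mk_eq.2 (.sup_assoc x y z))
    (ind fun x => ind fun y => mk_eq.2 (.inf_comm x y))
    (ind fun x => ind fun y => ind fun z => mk_eq.2 (.inf_assoc x y z))
    (ind fun x => ind fun y => mk_eq.2 (.sup_inf_self x y))
    (ind fun x => ind fun y => mk_eq.2 (.inf_sup_self x y))

theorem mk_le {x y : CkTerm X} :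
    (mk x : FreeCk k X) ≤ mk y ↔ CkTerm.Eqv k (CkTerm.inf x y) x := by
  rw [← inf_eq_left]
  exact mk_eq

instance instDistribLattice : DistribLattice (FreeCk k X) where
  le_sup_inf := ind fun x => ind fun y => ind fun z => by
    have h : ((mk x ⊔ mk y) ⊓ (mk x ⊔ mk z) : FreeCk k X) = mk x ⊔ (mk y ⊓ mk z) :=
      mk_eq.2 (.distrib x y z)
    exact h.le

instance instBoundedOrder : BoundedOrder (FreeCk k X) where
  bot := mk .bot
  top := mk .top
  bot_le := ind fun x => mk_le.2 (.bot_inf x)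
  le_top := ind fun x => mk_le.2 (.inf_top x)

instance instMpMAlgebra : MpMAlgebra (FreeCk k X) where
  dm := Quotient.map CkTerm.dm fun _ _ h => CkTerm.Eqv.congr_dm h
  pc := Quotient.map CkTerm.pc fun _ _ h => CkTerm.Eqv.congr_pc h
  dm_dm := ind fun x => mk_eq.2 (.dm_dm x)
  dm_sup := ind fun x => ind fun y => mk_eq.2 (.dm_sup x y)
  inf_eq_bot_iff := ind fun _ => ind fun _ =>
    ⟨fun h => mk_le.2 (.le_pc (mk_eq.1 h)), fun h => mk_eq.2 (.inf_pc (mk_le.1 h))⟩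
  tm := ind fun x => mk_le.2 (.tm x)

/-- The operation `t` of the free algebra. -/
def tMap : FreeCk k X → FreeCk k X := Quotient.map CkTerm.t fun _ _ h => CkTerm.Eqv.congr_t h

theorem tMap_iterate_mk (m : ℕ) (x : CkTerm X) :
    (tMap : FreeCk k X → FreeCk k X)^[m] (mk x) = mk (CkTerm.t^[m] x) := by
  induction m generalizing x with
  | zero => rfl
  | succ m ih => rw [Function.iterate_succ_apply, Function.iterate_succ_apply, ← ih]; rfl

theorem tMap_iterate (x : FreeCk k X) : tMap^[k] x = x :=
  ind (p := fun x => tMap^[k] x = x)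
    (fun x => (tMap_iterate_mk k x).trans (mk_eq.2 (.t_iterate x))) x

instance instCkAlgebra [NeZero k] : CkAlgebra k (FreeCk k X) where
  t := tMap
  t_hom :=
    { map_bot := mk_eq.2 .t_bot
      map_top := mk_eq.2 .t_top
      map_inf := ind fun x => ind fun y => mk_eq.2 (.t_inf x y)
      map_sup := ind fun x => ind fun y => mk_eq.2 (.t_sup x y)
      map_dm := ind fun x => mk_eq.2 (.t_dm x)
      map_pc := ind fun x => mk_eq.2 (.t_pc x) }
  t_bijective := by
    obtain ⟨m, hm⟩ := Nat.exists_eq_succ_of_ne_zero (NeZero.ne k)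
    have key : ∀ x : FreeCk k X, tMap^[m.succ] x = x := fun x => by
      simpa only [← hm] using tMap_iterate x
    exact ⟨Function.LeftInverse.injective (g := tMap^[m]) fun x =>
        (Function.iterate_succ_apply tMap m x).symm.trans (key x),
      Function.RightInverse.surjective (g := tMap^[m]) fun x =>
        (Function.iterate_succ_apply' tMap m x).symm.trans (key x)⟩
  t_iterate := tMap_iterate

/-- The universal property of the free `C_k`-algebra: every map from the generators into a
`C_k`-algebra extends to exactly one homomorphism. -/
theorem existsUnique_lift [NeZero k] {A : Type*} [CkAlgebra k A] (v : X → A) :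
    ∃! f : FreeCk k X → A, IsCkHom k f ∧ ∀ i, f (of i) = v i := by
  refine ⟨Quotient.lift (CkTerm.eval k v) fun _ _ h => CkTerm.eval_eq_of_eqv k v h,
    ⟨⟨⟨rfl, rfl, ind fun _ => ind fun _ => rfl, ind fun _ => ind fun _ => rfl,
      ind fun _ => rfl, ind fun _ => rfl⟩, ind fun _ => rfl⟩, fun _ => rfl⟩, ?_⟩
  rintro f ⟨hf, hv⟩
  funext x
  refine ind (p := fun x => f x = _) (fun x => ?_) x
  change f (mk x) = CkTerm.eval k v x
  induction x with
  | var i => exact hv i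
  | bot => exact hf.map_bot
  | top => exact hf.map_top
  | inf x y hx hy => exact (hf.map_inf (mk x) (mk y)).trans (by rw [hx, hy]; rfl)
  | sup x y hx hy => exact (hf.map_sup (mk x) (mk y)).trans (by rw [hx, hy]; rfl)
  | dm x hx => exact (hf.map_dm (mk x)).trans (by rw [hx]; rfl)
  | pc x hx => exact (hf.map_pc (mk x)).trans (by rw [hx]; rfl)
  | t x hx => exact (hf.map_t (mk x)).trans (by rw [hx]; rfl)

end FreeCk

/-- `M(d)`: the divisors of `d` different from `d` that are maximal, with respect to
divisibility, among the divisors of `d` different from `d`. -/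
def maxDivisors (d : ℕ) : Finset ℕ :=
  d.properDivisors.filter fun x => ∀ y ∈ d.properDivisors, x ∣ y → x = y

/-- `∑ (-1)^(|Z|-1) (c^gcd(Z))^n` over the nonempty `Z ⊆ M(d)`. -/
def sumOver (c n d : ℕ) : ℚ :=
  ∑ Z ∈ (maxDivisors d).powerset with Z.Nonempty,
    (-1 : ℚ) ^ (Z.card - 1) * ((c : ℚ) ^ (Z.gcd id)) ^ n

/-- `∑ (-1)^(|H|-1) (2^gcd(H₁ ∪ H₂))^n` over the nonempty `H ⊆ M(d) × M(d)`, where `H₁` and `H₂`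
are the two projections of `H`. -/
def sumOverPairs (n d : ℕ) : ℚ :=
  ∑ H ∈ (maxDivisors d ×ˢ maxDivisors d).powerset with H.Nonempty,
    (-1 : ℚ) ^ (H.card - 1) *
      ((2 : ℚ) ^ ((H.image Prod.fst ∪ H.image Prod.snd).gcd id)) ^ n

/-- The exponent `α_{2,d}`. -/
def alpha2 (n d : ℕ) : ℚ := ((2 ^ d) ^ n - sumOver 2 n d) / d

/-- The exponent `α_{3,d}`. -/
def alpha3 (n d : ℕ) : ℚ :=
  ((3 ^ d) ^ n - (2 ^ d) ^ n - sumOver 3 n d + sumOverPairs n d) / d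

/-- The exponent `α_{4,d}`; it need not be an integer. -/
def alpha4 (n d : ℕ) : ℚ :=
  ((4 ^ d) ^ n - sumOver 4 n d - (2 ^ d) ^ n + sumOverPairs n d) / (2 * d)

/-!
The prime filters of an mpM-algebra carry the order-reversing involution sending `P` to its dual
`{x | ∼x ∉ P}`, and the law `x ⊔ ∼x ≤ x ⊔ x*` forces a prime filter to be comparable with nothing
but itself and its dual. A finite algebra is therefore the lattice of upper sets of a disjoint
union of points, two-element chains and incomparable pairs. Its prime filters are counted by the
homomorphisms to the simple algebras with two, three and four elements, and if there are `h₂`, `h₃`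
and `h₄` of these, then the algebra has `2 ^ h₄ * 3 ^ (h₃ - h₂)` elements.

For the free `C_k`-algebra `F` these homomorphisms are easy to count: mpM-homomorphisms `F → B` are
the same as `C_k`-homomorphisms from `F` to the shift algebra `ZMod k → B`, that is, as families of
`k`-periodic words in the letters `B`, so there are `(|B| ^ k) ^ n` of them. Inclusion–exclusion
over `M(d)` identifies the numerators of the exponents with (differences of) numbers of words of
exact period `d`, and summing these over `d ∣ k` gives back the numbers of `k`-periodic words.
-/

section PrimeFilters

/-- The prime filters of a bounded lattice, each encoded by its membership predicate. -/
abbrev PrimeFilter (L : Type*) [Lattice L] [BoundedOrder L] : Type _ := BoundedLatticeHom L Prop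

namespace PrimeFilter

section Lattice

variable {L : Type*} [Lattice L] [BoundedOrder L] (P Q : PrimeFilter L)

instance instPartialOrder : PartialOrder (PrimeFilter L) :=
  PartialOrder.lift DFunLike.coe DFunLike.coe_injective

theorem le_def {P Q : PrimeFilter L} : P ≤ Q ↔ ∀ x, P x → Q x := Iff.rfl

theorem inf_iff (x y : L) : P (x ⊓ y) ↔ P x ∧ P y :=
  iff_of_eq (map_inf P x y)

theorem sup_iff (x y : L) : P (x ⊔ y) ↔ P x ∨ P y :=
  iff_of_eq (map_sup P x y)

theorem apply_top : P ⊤ := by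
  rw [map_top]
  trivial

theorem not_apply_bot : ¬ P ⊥ := by
  rw [map_bot]
  exact id

theorem finset_inf_iff {ι : Type*} (s : Finset ι) (f : ι → L) :
    P (s.inf f) ↔ ∀ i ∈ s, P (f i) := by
  rw [map_finset_inf, Finset.inf_eq_iInf]
  simp only [iInf_Prop_eq, Function.comp_apply]

theorem finset_sup_iff {ι : Type*} (s : Finset ι) (f : ι → L) :
    P (s.sup f) ↔ ∃ i ∈ s, P (f i) := by
  rw [map_finset_sup, Finset.sup_eq_iSup]
  simp only [iSup_Prop_eq, Function.comp_apply, exists_prop]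

theorem exists_forall_apply_iff_mem [Finite (PrimeFilter L)] (U : UpperSet (PrimeFilter L)) :
    ∃ x, ∀ P : PrimeFilter L, P x ↔ P ∈ U := by
  classical
  have := Fintype.ofFinite (PrimeFilter L)
  have separate : ∀ P Q : PrimeFilter L, ∃ x, ¬ P ≤ Q → P x ∧ ¬ Q x := fun P Q => by
    by_cases h : P ≤ Q
    · exact ⟨⊤, fun h' => absurd h h'⟩
    · obtain ⟨x, hx⟩ := not_forall.1 h
      exact ⟨x, fun _ => Classical.not_imp.1 hx⟩
  choose s hs using separate
  refine ⟨Finset.univ.filter (· ∈ U) |>.sup fun P => Finset.univ.filter (· ∉ U) |>.inf (s P),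
    fun P => ?_⟩
  simp only [finset_sup_iff, finset_inf_iff, Finset.mem_filter, Finset.mem_univ, true_and]
  constructor
  · rintro ⟨P', hP', h⟩
    by_contra hP
    exact (hs P' P fun hle => hP (U.upper hle hP')).2 (h P hP)
  · intro hP
    exact ⟨P, hP, fun Q hQ => (hs P Q fun hle => hQ (U.upper hle hP)).1⟩

end Lattice

section DistribLattice

variable {L : Type*} [DistribLattice L] [BoundedOrder L]

theorem exists_apply_and_not_apply {x y : L} (h : ¬ x ≤ y) : ∃ P : PrimeFilter L, P x ∧ ¬ P y := by
  have hdisj : Disjoint (Order.PFilter.principal x : Set L) (Order.Ideal.principal y) :=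
    Set.disjoint_left.2 fun z (hxz : x ≤ z) (hzy : z ≤ y) => h (hxz.trans hzy)
  obtain ⟨J, hJ, hyJ, hxJ⟩ := DistribLattice.prime_ideal_of_disjoint_filter_ideal hdisj
  refine ⟨{ toFun := fun z => z ∉ J, map_sup' := ?_, map_inf' := ?_, map_top' := ?_,
            map_bot' := ?_ }, ?_, ?_⟩
  · exact fun a b => propext (Order.Ideal.sup_mem_iff.not.trans not_and_or)
  · have inf_mem_iff (a b : L) : a ⊓ b ∈ J ↔ a ∈ J ∨ b ∈ J :=
      ⟨hJ.mem_or_mem, Or.rec (J.lower inf_le_left) (J.lower inf_le_right)⟩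
    exact fun a b => propext ((inf_mem_iff a b).not.trans not_or)
  · exact eq_true hJ.top_notMem
  · exact eq_false (not_not.2 J.bot_mem)
  · exact Set.disjoint_left.1 hxJ (le_refl x)
  · exact not_not.2 (hyJ (le_refl y))

/-- The upper set of the prime filters that contain `x`: Priestley's representation of `L`. -/
def representation (x : L) : UpperSet (PrimeFilter L) :=
  ⟨{P | P x}, fun _ _ hPQ => hPQ x⟩

theorem representation_injective : Function.Injective (representation (L := L)) := by
  have le_of_representation_eq {x y : L} (h : representation x = representation y) : x ≤ y := by
    by_contra hxy
    obtain ⟨P, hx, hy⟩ := exists_apply_and_not_apply hxy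
    exact hy (SetLike.ext_iff.1 h P |>.1 hx)
  exact fun x y h => le_antisymm (le_of_representation_eq h) (le_of_representation_eq h.symm)

theorem representation_bijective [Finite (PrimeFilter L)] :
    Function.Bijective (representation (L := L)) :=
  ⟨representation_injective, fun U =>
    (exists_forall_apply_iff_mem U).imp fun _ hx => SetLike.ext hx⟩

end DistribLattice

end PrimeFilter

end PrimeFilters

section InvolutivePoset

theorem card_prop_prod_le : Nat.card {p : Prop × Prop // p.1 ≤ p.2} = 3 := by
  have e : {p : Prop × Prop // p.1 ≤ p.2} ≃ {p : Bool × Bool // p.1 ≤ p.2} :=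
    (Equiv.prodCongr Equiv.propEquivBool Equiv.propEquivBool).subtypeEquiv fun p => by
      simp [Bool.le_iff_imp, Equiv.propEquivBool]
  rw [Nat.card_congr e, Nat.card_eq_fintype_card]
  decide

variable {S : Type*} [PartialOrder S] {g : S → S}

/-- The trace of an upper set `U` on the blocks `{x, g x}`: for `x` equal or incomparable to `g x`,
whether `x ∈ U`; for `x < g x`, whether `x ∈ U` and whether `g x ∈ U`. -/
def blockTrace (g : S → S) (U : UpperSet S) :
    ({x // ¬ x < g x ∧ ¬ g x < x} → Prop) × ({x // x < g x} → {p : Prop × Prop // p.1 ≤ p.2}) :=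
  (fun x => x.1 ∈ U, fun x => ⟨(x.1 ∈ U, g x.1 ∈ U), U.upper x.2.le⟩)

theorem blockTrace_injective (hg : Function.Involutive g) :
    Function.Injective (blockTrace g) := by
  intro U V h
  obtain ⟨hfst, hsnd⟩ := Prod.ext_iff.1 h
  have of_lt (x : S) (hx : x < g x) : (x ∈ U ↔ x ∈ V) ∧ (g x ∈ U ↔ g x ∈ V) := by
    have hpair := Prod.ext_iff.1 (Subtype.ext_iff.1 (congrFun hsnd ⟨x, hx⟩))
    exact ⟨iff_of_eq hpair.1, iff_of_eq hpair.2⟩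
  refine SetLike.ext fun x => ?_
  by_cases hx : x < g x
  · exact (of_lt x hx).1
  by_cases hx' : g x < x
  · simpa only [hg x] using (of_lt (g x) (by rwa [hg x])).2
  · exact iff_of_eq (congrFun hfst ⟨x, hx, hx'⟩)

theorem blockTrace_surjective (hg : Function.Involutive g)
    (hle : ∀ x y : S, x ≤ y → y = x ∨ y = g x) : Function.Surjective (blockTrace g) := by
  rintro ⟨φ, ψ⟩
  let U : Set S := {x | (∃ h, φ ⟨x, h⟩) ∨ (∃ h, (ψ ⟨x, h⟩).1.1) ∨
    ∃ h : g x < g (g x), (ψ ⟨g x, h⟩).1.2}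
  have mem_of_incomp (x : {x // ¬ x < g x ∧ ¬ g x < x}) : x.1 ∈ U ↔ φ x := by
    simp only [U, Set.mem_ofPred_eq, hg x.1, x.2.1, x.2.2, IsEmpty.exists_iff, or_false,
      not_false_eq_true, and_self, exists_true_left, Subtype.coe_eta]
  have mem_of_lt (x : {x // x < g x}) : x.1 ∈ U ↔ (ψ x).1.1 := by
    simp only [U, Set.mem_ofPred_eq, hg x.1, x.2, x.2.asymm, IsEmpty.exists_iff, or_false,
      not_true_eq_false, false_and, false_or, exists_true_left, Subtype.coe_eta]
  have map_mem_of_lt (x : {x // x < g x}) : g x.1 ∈ U ↔ (ψ x).1.2 := by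
    simp only [U, Set.mem_ofPred_eq, hg x.1, x.2, x.2.asymm, IsEmpty.exists_iff,
      not_true_eq_false, and_false, false_or, exists_true_left, Subtype.coe_eta]
  have hU : IsUpperSet U := by
    intro x y hxy hx
    obtain rfl | hlt := hxy.eq_or_lt
    · exact hx
    obtain rfl | rfl := hle x y hxy
    · exact hx
    · exact (map_mem_of_lt ⟨x, hlt⟩).2 ((ψ ⟨x, hlt⟩).2 ((mem_of_lt ⟨x, hlt⟩).1 hx))
  refine ⟨⟨U, hU⟩, Prod.ext (funext fun x => propext (mem_of_incomp x)) (funext fun x => ?_)⟩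
  exact Subtype.ext (Prod.ext (propext (mem_of_lt x)) (propext (map_mem_of_lt x)))

theorem card_upperSet_of_involutive [Finite S] (hg : Function.Involutive g)
    (hle : ∀ x y : S, x ≤ y → y = x ∨ y = g x) :
    Nat.card (UpperSet S) =
      2 ^ Nat.card {x // ¬ x < g x ∧ ¬ g x < x} * 3 ^ Nat.card {x // x < g x} := by
  rw [Nat.card_eq_of_bijective _ ⟨blockTrace_injective hg, blockTrace_surjective hg hle⟩,
    Nat.card_prod, Nat.card_fun, Nat.card_fun, card_prop_prod_le,
    Nat.card_congr Equiv.propEquivBool, Nat.card_eq_fintype_card (α := Bool), Fintype.card_bool]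

end InvolutivePoset

section Duality

open PrimeFilter

namespace MpMAlgebra

variable {A : Type*} [MpMAlgebra A]

theorem dm_inf (x y : A) : dm (x ⊓ y) = dm x ⊔ dm y := by
  rw [← dm_dm (dm x ⊔ dm y), dm_sup, dm_dm, dm_dm]

theorem dm_bot : dm (⊥ : A) = ⊤ := by
  rw [eq_top_iff, ← dm_dm (⊤ : A), ← left_eq_inf, ← dm_sup, sup_bot_eq]

theorem dm_top : dm (⊤ : A) = ⊥ := by rw [← dm_bot, dm_dm]

theorem inf_pc (x : A) : x ⊓ pc x = ⊥ := (inf_eq_bot_iff x _).2 le_rfl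

end MpMAlgebra

open MpMAlgebra

namespace PrimeFilter

variable {A : Type*} [MpMAlgebra A] {P Q : PrimeFilter A}

/-- The Białynicki-Birula–Rasiowa involution on prime filters, `P ↦ {x | ∼x ∉ P}`. -/
def dual (P : PrimeFilter A) : PrimeFilter A where
  toFun x := ¬ P (dm x)
  map_sup' x y := propext (by rw [dm_sup, inf_iff, not_and_or]; rfl)
  map_inf' x y := propext (by rw [dm_inf, sup_iff, not_or]; rfl)
  map_top' := eq_true (by rw [dm_top]; exact not_apply_bot P)
  map_bot' := eq_false (by rw [dm_bot, not_not]; exact apply_top P)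

theorem dual_apply (x : A) : dual P x ↔ ¬ P (dm x) := Iff.rfl

theorem apply_dm (x : A) : P (dm x) ↔ ¬ dual P x := by
  rw [dual_apply, not_not]

theorem dual_dual (P : PrimeFilter A) : dual (dual P) = P :=
  DFunLike.ext _ _ fun x => propext (by rw [dual_apply, dual_apply, not_not, dm_dm])

theorem dual_le_dual (h : P ≤ Q) : dual Q ≤ dual P := fun x => mt (h (dm x))

theorem not_apply_pc {x : A} (hx : P x) : ¬ P (pc x) := fun h =>
  not_apply_bot P (inf_pc x ▸ (inf_iff P _ _).2 ⟨hx, h⟩)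

theorem apply_pc_of_not_apply {x : A} (hx : ¬ P x) (hx' : ¬ dual P x) : P (pc x) := by
  have h : P (x ⊔ pc x) :=
    OrderHomClass.mono P (tm x) ((sup_iff P _ _).2 (.inr ((apply_dm x).2 hx')))
  exact ((sup_iff P _ _).1 h).resolve_left hx

theorem apply_pc_of_inf {x c : A} (hc : P c) (hx : ¬ P (x ⊓ c)) (hx' : ¬ dual P (x ⊓ c)) :
    P (pc x) := by
  have hle : c ⊓ pc (x ⊓ c) ≤ pc x := (inf_eq_bot_iff _ _).1 (by rw [← inf_assoc, inf_pc])
  exact OrderHomClass.mono P hle ((inf_iff P _ _).2 ⟨hc, apply_pc_of_not_apply hx hx'⟩)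

theorem apply_pc_iff (x : A) : P (pc x) ↔ ¬ P x ∧ (P ≤ dual P → ¬ dual P x) := by
  constructor
  · exact fun h => ⟨fun hx => not_apply_pc hx h, fun hle hx => not_apply_pc hx (hle _ h)⟩
  · rintro ⟨hx, hx'⟩
    by_cases hle : P ≤ dual P
    · exact apply_pc_of_not_apply hx (hx' hle)
    · obtain ⟨c, hc, hc'⟩ : ∃ c, P c ∧ ¬ dual P c := by simpa [le_def] using hle
      exact apply_pc_of_inf hc (fun h => hx ((inf_iff P _ _).1 h).1)
        fun h => hc' ((inf_iff _ _ _).1 h).2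

theorem le_dual_of_lt (h : P < Q) : Q ≤ dual P := by
  obtain ⟨hPQ, hQP⟩ := lt_iff_le_not_ge.1 h
  obtain ⟨x, hxQ, hxP⟩ : ∃ x, Q x ∧ ¬ P x := by simpa [le_def] using hQP
  intro y hyQ
  by_contra hy
  have hpc : P (pc (y ⊓ x)) := apply_pc_of_not_apply
    (fun h => hxP ((inf_iff P _ _).1 h).2) (fun h => hy ((inf_iff _ _ _).1 h).1)
  exact not_apply_pc ((inf_iff Q _ _).2 ⟨hyQ, hxQ⟩) (hPQ _ hpc)

theorem eq_or_eq_dual_of_le (h : P ≤ Q) : Q = P ∨ Q = dual P := by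
  obtain rfl | hPQ := h.eq_or_lt
  · exact .inl rfl
  · obtain hQ | hQ := (le_dual_of_lt hPQ).eq_or_lt
    · exact .inr hQ
    · have hQP : Q ≤ P := by simpa only [dual_dual] using dual_le_dual (le_dual_of_lt hQ)
      exact absurd hQP hPQ.not_ge

theorem card_eq_two_pow_mul_three_pow [Finite (PrimeFilter A)] :
    Nat.card A = 2 ^ Nat.card {P : PrimeFilter A // ¬ P < dual P ∧ ¬ dual P < P} *
      3 ^ Nat.card {P : PrimeFilter A // P < dual P} := by
  rw [Nat.card_eq_of_bijective _ representation_bijective,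
    card_upperSet_of_involutive dual_dual fun _ _ => eq_or_eq_dual_of_le]

end PrimeFilter

end Duality

section Homomorphisms

open MpMAlgebra PrimeFilter

variable {A B : Type*} [MpMAlgebra A] [MpMAlgebra B]

namespace PrimeFilter

/-- The inverse image of a prime filter under a homomorphism. -/
def comap (f : A → B) (hf : IsMpMHom f) (P : PrimeFilter B) : PrimeFilter A where
  toFun x := P (f x)
  map_sup' x y := by rw [hf.map_sup, map_sup]
  map_inf' x y := by rw [hf.map_inf, map_inf]
  map_top' := by rw [hf.map_top, map_top]
  map_bot' := by rw [hf.map_bot, map_bot]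

theorem comap_apply {f : A → B} (hf : IsMpMHom f) (P : PrimeFilter B) (x : A) :
    comap f hf P x ↔ P (f x) := Iff.rfl

theorem dual_comap {f : A → B} (hf : IsMpMHom f) (P : PrimeFilter B) :
    dual (comap f hf P) = comap f hf (dual P) :=
  DFunLike.ext _ _ fun x => propext (by
    rw [dual_apply, comap_apply, comap_apply, dual_apply, hf.map_dm])

/-- `P` and `dual P` are the only prime filters of `B` and describe its elements completely: each
membership pattern that respects the order between `P` and `dual P` comes from exactly one
element. Such `B` are the simple algebras. -/
def Coordinatizes (P : PrimeFilter B) : Prop :=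
  ∀ p q : Prop, (P ≤ dual P → p → q) → (dual P ≤ P → q → p) →
    ∃! b, (P b ↔ p) ∧ (dual P b ↔ q)

/-- The map `P ↦ Q`, `dual P ↦ dual Q` from `{P, dual P}` to `{Q, dual Q}` is a p-morphism, as the
dual of a homomorphism has to be: it is monotone, and strict inequalities in its image lift. -/
structure PMorphic (P : PrimeFilter B) (Q : PrimeFilter A) : Prop where
  le_dual : P ≤ dual P → Q ≤ dual Q
  dual_le : dual P ≤ P → dual Q ≤ Q
  lt_dual : Q < dual Q → P ≤ dual P
  dual_lt : dual Q < Q → dual P ≤ P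

variable {P : PrimeFilter B} {Q : PrimeFilter A}

theorem Coordinatizes.ext (hP : Coordinatizes P) {b c : B} (h : P b ↔ P c)
    (h' : dual P b ↔ dual P c) : b = c :=
  (hP (P c) (dual P c) (fun hle => hle c) (fun hle => hle c)).unique ⟨h, h'⟩ ⟨.rfl, .rfl⟩

theorem PMorphic.dual (h : PMorphic P Q) : PMorphic (dual P) (dual Q) where
  le_dual := by simpa only [dual_dual] using h.dual_le
  dual_le := by simpa only [dual_dual] using h.le_dual
  lt_dual := by simpa only [dual_dual] using h.dual_lt
  dual_lt := by simpa only [dual_dual] using h.lt_dual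

theorem PMorphic.apply_pc_iff (h : PMorphic P Q) (x : A) :
    Q (pc x) ↔ ¬ Q x ∧ (P ≤ PrimeFilter.dual P → ¬ PrimeFilter.dual Q x) := by
  rw [PrimeFilter.apply_pc_iff]
  refine and_congr_right fun hx => ⟨fun hQ hP => hQ (h.le_dual hP), fun hP hQ => ?_⟩
  obtain hQ | hQ := hQ.eq_or_lt
  · rwa [← hQ]
  · exact hP (h.lt_dual hQ)

theorem le_dual_of_comap_lt_dual {f : A → B} (hf : IsMpMHom f)
    (h : comap f hf P < dual (comap f hf P)) : P ≤ dual P := by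
  obtain ⟨hle, hnot⟩ := lt_iff_le_not_ge.1 h
  obtain ⟨x, hx', hx⟩ : ∃ x, dual (comap f hf P) x ∧ ¬ comap f hf P x := by
    simpa [le_def] using hnot
  by_contra hP
  refine ((apply_pc_iff x).1 ?_).2 hle hx'
  rw [comap_apply, hf.map_pc]
  exact (apply_pc_iff _).2 ⟨hx, fun h => absurd h hP⟩

theorem pMorphic_comap {f : A → B} (hf : IsMpMHom f) : PMorphic P (comap f hf P) where
  le_dual h := by rw [dual_comap]; exact fun x => h (f x)
  dual_le h := by rw [dual_comap]; exact fun x => h (f x)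
  lt_dual := le_dual_of_comap_lt_dual hf
  dual_lt h := by
    have := le_dual_of_comap_lt_dual (P := dual P) hf (by rwa [← dual_comap, dual_dual])
    rwa [dual_dual] at this

theorem PMorphic.isMpMHom (hP : Coordinatizes P) (h : PMorphic P Q) {f : A → B}
    (hf : ∀ x, (P (f x) ↔ Q x) ∧ (PrimeFilter.dual P (f x) ↔ PrimeFilter.dual Q x)) :
    IsMpMHom f where
  map_bot := hP.ext (by simp only [hf, not_apply_bot]) (by simp only [hf, not_apply_bot])
  map_top := hP.ext (by simp only [hf, apply_top]) (by simp only [hf, apply_top])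
  map_inf x y := hP.ext (by simp only [hf, inf_iff]) (by simp only [hf, inf_iff])
  map_sup x y := hP.ext (by simp only [hf, sup_iff]) (by simp only [hf, sup_iff])
  map_dm x := hP.ext (by simp only [hf, apply_dm])
    (by simp only [hf, dual_apply, dm_dm])
  map_pc x := hP.ext
    (by simp only [(hf _).1, h.apply_pc_iff, PrimeFilter.apply_pc_iff, (hf x).2])
    (by simp only [(hf _).2, h.dual.apply_pc_iff, PrimeFilter.apply_pc_iff, dual_dual, (hf x).1])

theorem PMorphic.exists_isMpMHom (hP : Coordinatizes P) (h : PMorphic P Q) :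
    ∃ (f : A → B) (hf : IsMpMHom f), comap f hf P = Q := by
  have pattern (x : A) := (hP (Q x) (PrimeFilter.dual Q x) (fun hle => h.le_dual hle x)
    fun hle => h.dual_le hle x).exists
  choose f hf using pattern
  exact ⟨f, h.isMpMHom hP hf, DFunLike.ext _ _ fun x => propext (hf x).1⟩

/-- Over a simple algebra, a homomorphism is determined by the prime filter it pulls back. -/
noncomputable def homEquiv (hP : Coordinatizes P) (A : Type*) [MpMAlgebra A] :
    {f : A → B // IsMpMHom f} ≃ {Q : PrimeFilter A // PMorphic P Q} :=
  Equiv.ofBijective (fun f => ⟨comap f.1 f.2 P, pMorphic_comap f.2⟩) <| by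
    constructor
    · intro f g h
      have hcomap : comap f.1 f.2 P = comap g.1 g.2 P := Subtype.ext_iff.1 h
      have hdual := congrArg PrimeFilter.dual hcomap
      rw [dual_comap, dual_comap] at hdual
      exact Subtype.ext (funext fun x => hP.ext (iff_of_eq (DFunLike.congr_fun hcomap x))
        (iff_of_eq (DFunLike.congr_fun hdual x)))
    · rintro ⟨Q, hQ⟩
      obtain ⟨f, hf, rfl⟩ := hQ.exists_isMpMHom hP
      exact ⟨⟨f, hf⟩, rfl⟩

theorem pMorphic_iff_dual_eq (hP : dual P = P) : PMorphic P Q ↔ Q = dual Q := by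
  constructor
  · exact fun h => le_antisymm (h.le_dual hP.ge) (h.dual_le hP.le)
  · exact fun h => ⟨fun _ => h.le, fun _ => h.ge, fun _ => hP.ge, fun _ => hP.le⟩

theorem pMorphic_iff_le_dual (hP : P < dual P) : PMorphic P Q ↔ Q ≤ dual Q := by
  constructor
  · exact fun h => h.le_dual hP.le
  · exact fun h => ⟨fun _ => h, fun h' => absurd h' hP.not_ge, fun _ => hP.le,
      fun h' => absurd h h'.not_ge⟩

theorem pMorphic_iff_not_lt (hP : ¬ P ≤ dual P) (hP' : ¬ dual P ≤ P) :
    PMorphic P Q ↔ ¬ Q < dual Q ∧ ¬ dual Q < Q := by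
  constructor
  · exact fun h => ⟨fun h' => hP (h.lt_dual h'), fun h' => hP' (h.dual_lt h')⟩
  · exact fun h => ⟨fun h' => absurd h' hP, fun h' => absurd h' hP', fun h' => absurd h' h.1,
      fun h' => absurd h' h.2⟩

end PrimeFilter

end Homomorphisms

section InclusionExclusion

theorem mem_properDivisors_of_mem_maxDivisors {d m : ℕ} (hm : m ∈ maxDivisors d) :
    m ∈ d.properDivisors :=
  (Finset.mem_filter.1 hm).1

theorem pos_of_mem_maxDivisors {d m : ℕ} (hm : m ∈ maxDivisors d) : 0 < m :=
  Nat.pos_of_mem_properDivisors (mem_properDivisors_of_mem_maxDivisors hm)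

theorem mem_properDivisors_iff_exists_dvd_maxDivisors {d e : ℕ} :
    e ∈ d.properDivisors ↔ ∃ m ∈ maxDivisors d, e ∣ m := by
  constructor
  · intro he
    obtain ⟨m, hm, hmax⟩ := Finset.exists_max_image {x ∈ d.properDivisors | e ∣ x} id
      ⟨e, Finset.mem_filter.2 ⟨he, dvd_rfl⟩⟩
    obtain ⟨hmd, hem⟩ := Finset.mem_filter.1 hm
    refine ⟨m, Finset.mem_filter.2 ⟨hmd, fun y hy hmy => ?_⟩, hem⟩
    exact le_antisymm (Nat.le_of_dvd (Nat.pos_of_mem_properDivisors hy) hmy)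
      (hmax y (Finset.mem_filter.2 ⟨hy, hem.trans hmy⟩))
  · rintro ⟨m, hm, hem⟩
    have hmd := Nat.mem_properDivisors.1 (mem_properDivisors_of_mem_maxDivisors hm)
    exact Nat.mem_properDivisors.2
      ⟨hem.trans hmd.1, (Nat.le_of_dvd (pos_of_mem_maxDivisors hm) hem).trans_lt hmd.2⟩

theorem biUnion_divisors_maxDivisors (d : ℕ) :
    (maxDivisors d).biUnion Nat.divisors = d.properDivisors := by
  ext e
  rw [mem_properDivisors_iff_exists_dvd_maxDivisors, Finset.mem_biUnion]
  refine exists_congr fun m => and_congr_right fun hm => ?_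
  rw [Nat.mem_divisors, and_iff_left (pos_of_mem_maxDivisors hm).ne']

theorem biUnion_divisors_gcd_maxDivisors (d : ℕ) :
    (maxDivisors d ×ˢ maxDivisors d).biUnion (fun p => (p.1.gcd p.2).divisors) =
      d.properDivisors := by
  ext e
  simp only [mem_properDivisors_iff_exists_dvd_maxDivisors, Finset.mem_biUnion,
    Finset.mem_product, Nat.mem_divisors, Nat.dvd_gcd_iff]
  constructor
  · rintro ⟨p, hp, hep, -⟩
    exact ⟨p.1, hp.1, hep.1⟩
  · rintro ⟨m, hm, hem⟩
    exact ⟨(m, m), ⟨hm, hm⟩, ⟨hem, hem⟩, by simpa using (pos_of_mem_maxDivisors hm).ne'⟩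

theorem inf'_divisors_eq_divisors_gcd {ι : Type*} {Z : Finset ι} (hZ : Z.Nonempty) {D : ι → ℕ}
    (hD : ∀ i ∈ Z, D i ≠ 0) : Z.inf' hZ (fun i => (D i).divisors) = (Z.gcd D).divisors := by
  have hgcd : Z.gcd D ≠ 0 := Finset.gcd_ne_zero_iff.2 (hZ.imp fun i hi => ⟨hi, hD i hi⟩)
  ext e
  simp only [Finset.mem_inf', Nat.mem_divisors, Finset.dvd_gcd_iff, and_iff_left hgcd]
  exact forall₂_congr fun j hj => and_iff_left (hD j hj)

theorem sum_nonempty_powerset_sum_divisors_gcd {ι R : Type*} [CommRing R] (I : Finset ι)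
    {D : ι → ℕ} (hD : ∀ i ∈ I, D i ≠ 0) (f : ℕ → R) :
    ∑ Z ∈ I.powerset with Z.Nonempty, (-1) ^ (Z.card - 1) * ∑ e ∈ (Z.gcd D).divisors, f e =
      ∑ e ∈ I.biUnion (fun i => (D i).divisors), f e := by
  rw [Finset.inclusion_exclusion_sum_biUnion,
    Finset.sum_coe_sort_eq_attach, ← Finset.sum_attach]
  refine Finset.sum_congr rfl fun Z _ => ?_
  obtain ⟨hZI, hZ⟩ := Finset.mem_filter.1 Z.2
  obtain ⟨m, hm⟩ := Nat.exists_eq_add_of_lt hZ.card_pos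
  rw [inf'_divisors_eq_divisors_gcd hZ fun i hi => hD i (Finset.mem_powerset.1 hZI hi), hm]
  simp [zsmul_eq_mul, pow_succ]

/-- The number of `n`-tuples of `d`-periodic words in `c` letters that have no common period
smaller than `d`, written as the Möbius inverse of the number `(c ^ d) ^ n` of all of them. -/
def aperiodicCount (c n d : ℕ) : ℚ :=
  ∑ x ∈ d.divisorsAntidiagonal, (ArithmeticFunction.moebius x.1 : ℚ) * ((c : ℚ) ^ x.2) ^ n

theorem sum_divisors_aperiodicCount (c n : ℕ) {d : ℕ} (hd : 0 < d) :
    ∑ e ∈ d.divisors, aperiodicCount c n e = ((c : ℚ) ^ d) ^ n :=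
  ArithmeticFunction.sum_eq_iff_sum_mul_moebius_eq (f := aperiodicCount c n)
    (g := fun m => ((c : ℚ) ^ m) ^ n) |>.2 (fun _ _ => rfl) d hd

theorem sum_properDivisors_aperiodicCount (c n : ℕ) {d : ℕ} (hd : 0 < d) :
    ∑ e ∈ d.properDivisors, aperiodicCount c n e =
      ((c : ℚ) ^ d) ^ n - aperiodicCount c n d := by
  rw [← sum_divisors_aperiodicCount c n hd, ← Nat.cons_self_properDivisors hd.ne',
    Finset.sum_cons, add_sub_cancel_left]

theorem sum_nonempty_powerset_pow_gcd {ι : Type*} (c n : ℕ) (I : Finset ι) {D : ι → ℕ}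
    (hD : ∀ i ∈ I, D i ≠ 0) :
    ∑ Z ∈ I.powerset with Z.Nonempty, (-1) ^ (Z.card - 1) * ((c : ℚ) ^ Z.gcd D) ^ n =
      ∑ e ∈ I.biUnion (fun i => (D i).divisors), aperiodicCount c n e := by
  rw [← sum_nonempty_powerset_sum_divisors_gcd I hD]
  refine Finset.sum_congr rfl fun Z hZ => ?_
  obtain ⟨hZI, i, hi⟩ := Finset.mem_filter.1 hZ
  have hgcd : Z.gcd D ≠ 0 :=
    Finset.gcd_ne_zero_iff.2 ⟨i, hi, hD i (Finset.mem_powerset.1 hZI hi)⟩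
  rw [sum_divisors_aperiodicCount c n (Nat.pos_of_ne_zero hgcd)]

theorem sumOver_eq (c n : ℕ) {d : ℕ} (hd : 0 < d) :
    sumOver c n d = ((c : ℚ) ^ d) ^ n - aperiodicCount c n d := by
  rw [← sum_properDivisors_aperiodicCount c n hd, ← biUnion_divisors_maxDivisors]
  exact sum_nonempty_powerset_pow_gcd c n _ (D := id) fun m hm => (pos_of_mem_maxDivisors hm).ne'

theorem gcd_image_fst_union_image_snd (H : Finset (ℕ × ℕ)) :
    (H.image Prod.fst ∪ H.image Prod.snd).gcd id = H.gcd fun p => p.1.gcd p.2 := by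
  refine Nat.dvd_left_iff_eq.1 fun e => ?_
  simp only [Finset.gcd_union, Finset.gcd_image, Function.id_comp, dvd_gcd_iff,
    Finset.dvd_gcd_iff, Nat.dvd_gcd_iff, forall_and]

theorem sumOverPairs_eq (n : ℕ) {d : ℕ} (hd : 0 < d) :
    sumOverPairs n d = (2 ^ d) ^ n - aperiodicCount 2 n d := by
  have hgcd : ∀ p ∈ maxDivisors d ×ˢ maxDivisors d, p.1.gcd p.2 ≠ 0 := fun p hp =>
    (Nat.gcd_pos_of_pos_left _ (pos_of_mem_maxDivisors (Finset.mem_product.1 hp).1)).ne'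
  have hsum := sum_nonempty_powerset_pow_gcd 2 n _ hgcd
  rw [biUnion_divisors_gcd_maxDivisors, sum_properDivisors_aperiodicCount 2 n hd] at hsum
  simpa only [sumOverPairs, gcd_image_fst_union_image_snd, Nat.cast_ofNat] using hsum

end InclusionExclusion

section Exponents

theorem alpha2_eq (n : ℕ) {d : ℕ} (hd : 0 < d) : alpha2 n d = aperiodicCount 2 n d / d := by
  rw [alpha2, sumOver_eq 2 n hd, Nat.cast_ofNat, sub_sub_cancel]

theorem alpha3_eq (n : ℕ) {d : ℕ} (hd : 0 < d) :
    alpha3 n d = (aperiodicCount 3 n d - aperiodicCount 2 n d) / d := by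
  rw [alpha3, sumOver_eq 3 n hd, sumOverPairs_eq n hd, Nat.cast_ofNat]
  ring

theorem alpha4_eq (n : ℕ) {d : ℕ} (hd : 0 < d) :
    alpha4 n d = (aperiodicCount 4 n d - aperiodicCount 2 n d) / (2 * d) := by
  rw [alpha4, sumOver_eq 4 n hd, sumOverPairs_eq n hd, Nat.cast_ofNat]
  ring

theorem sum_mul_alpha2 (n : ℕ) {k : ℕ} (hk : 0 < k) :
    ∑ d ∈ k.divisors, d * alpha2 n d = (2 ^ k) ^ n := by
  rw [← show _ = ((2 : ℚ) ^ k) ^ n from sum_divisors_aperiodicCount 2 n hk]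
  refine Finset.sum_congr rfl fun d hd => ?_
  have hd : 0 < d := Nat.pos_of_mem_divisors hd
  rw [alpha2_eq n hd]
  field_simp

theorem sum_mul_alpha3 (n : ℕ) {k : ℕ} (hk : 0 < k) :
    ∑ d ∈ k.divisors, d * alpha3 n d = (3 ^ k) ^ n - (2 ^ k) ^ n := by
  rw [← show _ = ((3 : ℚ) ^ k) ^ n from sum_divisors_aperiodicCount 3 n hk,
    ← show _ = ((2 : ℚ) ^ k) ^ n from sum_divisors_aperiodicCount 2 n hk,
    ← Finset.sum_sub_distrib]
  refine Finset.sum_congr rfl fun d hd => ?_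
  have hd : 0 < d := Nat.pos_of_mem_divisors hd
  rw [alpha3_eq n hd]
  field_simp

theorem sum_mul_alpha4 (n : ℕ) {k : ℕ} (hk : 0 < k) :
    ∑ d ∈ k.divisors, d * alpha4 n d = ((4 ^ k) ^ n - (2 ^ k) ^ n) / 2 := by
  rw [← show _ = ((4 : ℚ) ^ k) ^ n from sum_divisors_aperiodicCount 4 n hk,
    ← show _ = ((2 : ℚ) ^ k) ^ n from sum_divisors_aperiodicCount 2 n hk,
    ← Finset.sum_sub_distrib, Finset.sum_div]
  refine Finset.sum_congr rfl fun d hd => ?_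
  have hd : 0 < d := Nat.pos_of_mem_divisors hd
  rw [alpha4_eq n hd]
  field_simp

theorem prod_pow_rpow_eq_rpow_sum {b : ℝ} (hb : 0 < b) (s : Finset ℕ) (α : ℕ → ℚ) :
    ∏ d ∈ s, (b ^ d) ^ (α d : ℝ) = b ^ ((∑ d ∈ s, d * α d : ℚ) : ℝ) := by
  rw [Rat.cast_sum, Real.rpow_sum_of_pos hb]
  refine Finset.prod_congr rfl fun d _ => ?_
  rw [Rat.cast_mul, Rat.cast_natCast, Real.rpow_mul hb.le, Real.rpow_natCast]

theorem four_rpow_half (x : ℝ) : (4 : ℝ) ^ (x / 2) = 2 ^ x := by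
  rw [show (4 : ℝ) = 2 ^ (2 : ℝ) by norm_num, ← Real.rpow_mul two_pos.le,
    mul_div_cancel₀ x two_ne_zero]

end Exponents

section SimpleAlgebras

open MpMAlgebra PrimeFilter

namespace MpMAlgebra

instance instBool : MpMAlgebra Bool where
  dm := not
  pc := not
  dm_dm := by decide
  dm_sup := by decide
  inf_eq_bot_iff := by decide
  tm := by decide

noncomputable instance instFinThree : MpMAlgebra (Fin 3) where
  dm := Fin.rev
  pc x := if x = 0 then 2 else 0
  dm_dm := by decide
  dm_sup := by decide
  inf_eq_bot_iff := by decide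
  tm := by decide

-- Not the product of two copies of `Bool`: here `∼` fixes both atoms.
instance instBoolProdBool : MpMAlgebra (Bool × Bool) where
  dm x := (!x.2, !x.1)
  pc x := (!x.1, !x.2)
  dm_dm := by decide
  dm_sup := by decide
  inf_eq_bot_iff := by decide
  tm := by decide

end MpMAlgebra

namespace PrimeFilter

/-- The only prime filter `{true}` of `Bool`. -/
def boolTop : PrimeFilter Bool where
  toFun x := x = true
  map_sup' x y := propext (show x ⊔ y = true ↔ x = true ∨ y = true by revert x y; decide)
  map_inf' x y := propext (show x ⊓ y = true ↔ x = true ∧ y = true by revert x y; decide)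
  map_top' := eq_true rfl
  map_bot' := eq_false (by decide)

/-- The prime filter `{2}` of `Fin 3`; its dual is `{1, 2}`. -/
def finThreeTop : PrimeFilter (Fin 3) where
  toFun x := x = 2
  map_sup' x y := propext (show x ⊔ y = 2 ↔ x = 2 ∨ y = 2 by revert x y; decide)
  map_inf' x y := propext (show x ⊓ y = 2 ↔ x = 2 ∧ y = 2 by revert x y; decide)
  map_top' := eq_true rfl
  map_bot' := eq_false (by decide)

/-- The prime filter of `Bool × Bool` generated by the atom `(true, false)`; its dual is generated
by the other atom. -/
def boolProdFst : PrimeFilter (Bool × Bool) where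
  toFun x := x.1 = true
  map_sup' x y := propext (show (x ⊔ y).1 = true ↔ x.1 = true ∨ y.1 = true by revert x y; decide)
  map_inf' x y := propext (show (x ⊓ y).1 = true ↔ x.1 = true ∧ y.1 = true by revert x y; decide)
  map_top' := eq_true rfl
  map_bot' := eq_false (by decide)

theorem dual_boolTop : dual boolTop = boolTop :=
  DFunLike.ext _ _ fun x => propext (show ¬ (!x) = true ↔ x = true by simp)

theorem finThreeTop_lt_dual : finThreeTop < dual finThreeTop := by
  refine lt_iff_le_not_ge.2 ⟨?_, fun h => ?_⟩
  · exact show ∀ x : Fin 3, x = 2 → ¬ x.rev = 2 by decide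
  · exact absurd (h 1) (show ¬ (¬ (1 : Fin 3).rev = 2 → (1 : Fin 3) = 2) by decide)

theorem not_boolProdFst_le_dual : ¬ boolProdFst ≤ dual boolProdFst := fun h =>
  absurd (h (true, false)) (show ¬ (true = true → ¬ (!false) = true) by decide)

theorem not_dual_boolProdFst_le : ¬ dual boolProdFst ≤ boolProdFst := fun h =>
  absurd (h (false, true)) (show ¬ (¬ (!true) = true → false = true) by decide)

theorem coordinatizes_boolTop : Coordinatizes boolTop := by
  intro p q hpq hqp
  have hpq : p ↔ q := ⟨hpq dual_boolTop.ge, hqp dual_boolTop.le⟩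
  change ∃! b : Bool, (b = true ↔ p) ∧ (¬ (!b) = true ↔ q)
  by_cases hq : q <;> simp only [ExistsUnique, hpq, hq] <;> decide

theorem coordinatizes_finThreeTop : Coordinatizes finThreeTop := by
  intro p q hpq _
  have hpq : p → q := hpq finThreeTop_lt_dual.le
  change ∃! b : Fin 3, (b = 2 ↔ p) ∧ (¬ b.rev = 2 ↔ q)
  by_cases hp : p
  · simp only [ExistsUnique, hp, hpq hp]
    decide
  · by_cases hq : q <;> simp only [ExistsUnique, hp, hq] <;> decide

theorem coordinatizes_boolProdFst : Coordinatizes boolProdFst := by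
  intro p q _ _
  change ∃! b : Bool × Bool, (b.1 = true ↔ p) ∧ (¬ (!b.2) = true ↔ q)
  by_cases hp : p <;> by_cases hq : q <;> simp only [ExistsUnique, hp, hq] <;> decide

end PrimeFilter

namespace MpMAlgebra

variable (A : Type*) [MpMAlgebra A]

/-- Homomorphisms to `Bool` correspond to the prime filters fixed by `dual`. -/
noncomputable def boolHomEquiv :
    {f : A → Bool // IsMpMHom f} ≃ {P : PrimeFilter A // P = dual P} :=
  (homEquiv coordinatizes_boolTop A).trans
    (Equiv.subtypeEquivRight fun _ => pMorphic_iff_dual_eq dual_boolTop)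

/-- Homomorphisms to `Fin 3` correspond to the prime filters contained in their dual. -/
noncomputable def finThreeHomEquiv :
    {f : A → Fin 3 // IsMpMHom f} ≃ {P : PrimeFilter A // P ≤ dual P} :=
  (homEquiv coordinatizes_finThreeTop A).trans
    (Equiv.subtypeEquivRight fun _ => pMorphic_iff_le_dual finThreeTop_lt_dual)

/-- Homomorphisms to `Bool × Bool` correspond to the prime filters that are not strictly comparable
with their dual. -/
noncomputable def boolProdHomEquiv :
    {f : A → Bool × Bool // IsMpMHom f} ≃ {P : PrimeFilter A // ¬ P < dual P ∧ ¬ dual P < P} :=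
  (homEquiv coordinatizes_boolProdFst A).trans
    (Equiv.subtypeEquivRight fun _ => pMorphic_iff_not_lt not_boolProdFst_le_dual
      not_dual_boolProdFst_le)

variable [Finite {f : A → Fin 3 // IsMpMHom f}]

theorem card_lt_dual_add_card_boolHom :
    Nat.card {P : PrimeFilter A // P < dual P} + Nat.card {f : A → Bool // IsMpMHom f} =
      Nat.card {f : A → Fin 3 // IsMpMHom f} := by
  classical
  have hdisj : Disjoint (fun P : PrimeFilter A => P < dual P) (fun P => P = dual P) :=
    Pi.disjoint_iff.2 fun P => Prop.disjoint_iff.2 fun h => h.1.ne h.2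
  let split : {P : PrimeFilter A // P ≤ dual P} ≃ {P // P < dual P} ⊕ {P // P = dual P} :=
    (Equiv.subtypeEquivRight fun _ => le_iff_lt_or_eq).trans (subtypeOrEquiv _ _ hdisj)
  have := Finite.of_equiv _ ((finThreeHomEquiv A).trans split)
  have : Finite {P : PrimeFilter A // P < dual P} :=
    Finite.sum_left {P : PrimeFilter A // P = dual P}
  have : Finite {P : PrimeFilter A // P = dual P} :=
    Finite.sum_right {P : PrimeFilter A // P < dual P}
  rw [Nat.card_congr (boolHomEquiv A), ← Nat.card_sum,
    Nat.card_congr ((finThreeHomEquiv A).trans split)]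

variable [Finite {f : A → Bool × Bool // IsMpMHom f}]

theorem finite_primeFilter : Finite (PrimeFilter A) := by
  have hle : {P : PrimeFilter A | P ≤ dual P}.Finite := .of_equiv _ (finThreeHomEquiv A)
  have hnot : {P : PrimeFilter A | ¬ P < dual P ∧ ¬ dual P < P}.Finite :=
    .of_equiv _ (boolProdHomEquiv A)
  refine Set.finite_univ_iff.1 (((hle.union (hle.image dual)).union hnot).subset fun P _ => ?_)
  by_cases hlt : P < dual P
  · exact .inl (.inl hlt.le)
  by_cases hgt : dual P < P
  · exact .inl (.inr ⟨dual P, by simpa only [Set.mem_ofPred_eq, dual_dual] using hgt.le,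
      dual_dual P⟩)
  · exact .inr ⟨hlt, hgt⟩

theorem finite_of_finite_hom : Finite A :=
  have := finite_primeFilter A
  .of_injective _ representation_injective

theorem card_eq_two_pow_mul_three_pow_card_hom :
    Nat.card A = 2 ^ Nat.card {f : A → Bool × Bool // IsMpMHom f} *
      3 ^ (Nat.card {f : A → Fin 3 // IsMpMHom f} - Nat.card {f : A → Bool // IsMpMHom f}) := by
  have := finite_primeFilter A
  rw [card_eq_two_pow_mul_three_pow, ← card_lt_dual_add_card_boolHom, Nat.add_sub_cancel,
    Nat.card_congr (boolProdHomEquiv A)]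

end MpMAlgebra

end SimpleAlgebras

section FreeAlgebra

open MpMAlgebra

namespace MpMAlgebra

instance instPi {ι B : Type*} [MpMAlgebra B] : MpMAlgebra (ι → B) where
  dm x i := dm (x i)
  pc x i := pc (x i)
  dm_dm x := funext fun i => dm_dm (x i)
  dm_sup x y := funext fun i => dm_sup (x i) (y i)
  inf_eq_bot_iff a x := by
    simp only [funext_iff, Pi.le_def, Pi.inf_apply, Pi.bot_apply, inf_eq_bot_iff]
  tm x i := tm (x i)

end MpMAlgebra

namespace IsMpMHom

variable {A B C : Type*} [MpMAlgebra A] [MpMAlgebra B] [MpMAlgebra C]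

theorem comp {g : B → C} {f : A → B} (hg : IsMpMHom g) (hf : IsMpMHom f) : IsMpMHom (g ∘ f) where
  map_bot := by simp only [Function.comp_apply, hf.map_bot, hg.map_bot]
  map_top := by simp only [Function.comp_apply, hf.map_top, hg.map_top]
  map_inf x y := by simp only [Function.comp_apply, hf.map_inf, hg.map_inf]
  map_sup x y := by simp only [Function.comp_apply, hf.map_sup, hg.map_sup]
  map_dm x := by simp only [Function.comp_apply, hf.map_dm, hg.map_dm]
  map_pc x := by simp only [Function.comp_apply, hf.map_pc, hg.map_pc]

theorem iterate {f : A → A} (hf : IsMpMHom f) (m : ℕ) : IsMpMHom f^[m] := by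
  induction m with
  | zero => exact ⟨rfl, rfl, fun _ _ => rfl, fun _ _ => rfl, fun _ => rfl, fun _ => rfl⟩
  | succ m ih => exact ih.comp hf

theorem pi {ι : Type*} {f : ι → A → B} (hf : ∀ i, IsMpMHom (f i)) :
    IsMpMHom (fun x i => f i x) where
  map_bot := funext fun i => (hf i).map_bot
  map_top := funext fun i => (hf i).map_top
  map_inf x y := funext fun i => (hf i).map_inf x y
  map_sup x y := funext fun i => (hf i).map_sup x y
  map_dm x := funext fun i => (hf i).map_dm x
  map_pc x := funext fun i => (hf i).map_pc x

theorem eval {ι : Type*} (i : ι) : IsMpMHom (fun x : ι → B => x i) :=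
  ⟨rfl, rfl, fun _ _ => rfl, fun _ _ => rfl, fun _ => rfl, fun _ => rfl⟩

end IsMpMHom

namespace CkAlgebra

variable {k : ℕ} {A B : Type*}

theorem iterate_shift (m : ℕ) (x : ZMod k → B) :
    (fun y : ZMod k → B => fun j => y (j + 1))^[m] x = fun j => x (j + m) := by
  induction m generalizing x with
  | zero => simp
  | succ m ih =>
    rw [Function.iterate_succ_apply, ih]
    exact funext fun j => by rw [Nat.cast_succ, add_assoc]

variable [MpMAlgebra B]

instance instZModPi : CkAlgebra k (ZMod k → B) where
  t x j := x (j + 1)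
  t_hom := .pi fun j => .eval (j + 1)
  t_bijective := ((Equiv.addRight 1).arrowCongr (Equiv.refl B)).symm.bijective
  t_iterate x := by
    rw [iterate_shift]
    simp

theorem iterate_t_apply (m : ℕ) (x : ZMod k → B) (j : ZMod k) : (t k)^[m] x j = x (j + m) :=
  congrFun (iterate_shift m x) j

variable [CkAlgebra k A]

theorem iterate_t_eq {l m : ℕ} (h : (l : ZMod k) = m) (x : A) : (t k)^[l] x = (t k)^[m] x := by
  have hper : Function.IsPeriodicPt (t k) k x := t_iterate x
  rw [← hper.iterate_mod_apply l, ← hper.iterate_mod_apply m,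
    (ZMod.natCast_eq_natCast_iff' l m k).1 h]

variable [NeZero k]

theorem isCkHom_orbit {f : A → B} (hf : IsMpMHom f) :
    IsCkHom k fun (x : A) (j : ZMod k) => f ((t k)^[j.val] x) where
  toIsMpMHom := .pi fun j => hf.comp (t_hom.iterate j.val)
  map_t x := funext fun j => by
    change f ((t k)^[j.val + 1] x) = f ((t k)^[(j + 1).val] x)
    rw [iterate_t_eq (l := j.val + 1) (m := (j + 1).val) (by simp)]

variable (k A B) in
/-- The shift algebra `ZMod k → B` is the cofree `C_k`-algebra on the mpM-algebra `B`. -/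
def homEquivZModPi :
    {f : A → B // IsMpMHom f} ≃ {F : A → ZMod k → B // IsCkHom k F} where
  toFun f := ⟨fun x j => f.1 ((t k)^[j.val] x), isCkHom_orbit f.2⟩
  invFun F := ⟨fun x => F.1 x 0, (IsMpMHom.eval 0).comp F.2.toIsMpMHom⟩
  left_inv f := Subtype.ext <| by simp
  right_inv F := Subtype.ext <| funext fun x => funext fun j => by
    have hsemi : Function.Semiconj F.1 (t k) (t k) := F.2.map_t
    change F.1 ((t k)^[j.val] x) 0 = F.1 x j
    rw [(hsemi.iterate_right j.val).eq, iterate_t_apply, zero_add, ZMod.natCast_zmod_val]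

end CkAlgebra

namespace FreeCk

variable (k : ℕ) [NeZero k] (X : Type*)

/-- The universal property of `FreeCk k X` as a bijection. -/
noncomputable def liftEquiv (C : Type*) [CkAlgebra k C] :
    {F : FreeCk k X → C // IsCkHom k F} ≃ (X → C) :=
  Equiv.ofBijective (fun F i => F.1 (of i)) <| by
    constructor
    · intro F G h
      exact Subtype.ext ((existsUnique_lift (k := k) fun i => F.1 (of i)).unique
        ⟨F.2, fun _ => rfl⟩ ⟨G.2, fun i => (congrFun h i).symm⟩)
    · intro v
      obtain ⟨F, hF, hv⟩ := (existsUnique_lift (k := k) v).exists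
      exact ⟨⟨F, hF⟩, funext hv⟩

/-- Homomorphisms of mpM-algebras out of `FreeCk k X` are families of words indexed by `X`. -/
noncomputable def mpMHomEquiv (B : Type*) [MpMAlgebra B] :
    {f : FreeCk k X → B // IsMpMHom f} ≃ (X → ZMod k → B) :=
  (CkAlgebra.homEquivZModPi k (FreeCk k X) B).trans (liftEquiv k X (ZMod k → B))

instance instFiniteMpMHom [Finite X] (B : Type*) [MpMAlgebra B] [Finite B] :
    Finite {f : FreeCk k X → B // IsMpMHom f} :=
  .of_equiv _ (mpMHomEquiv k X B).symm

variable [Finite X]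

theorem card_mpMHom (B : Type*) [MpMAlgebra B] :
    Nat.card {f : FreeCk k X → B // IsMpMHom f} = (Nat.card B ^ k) ^ Nat.card X := by
  rw [Nat.card_congr (mpMHomEquiv k X B), Nat.card_fun, Nat.card_fun, Nat.card_zmod]

instance instFinite : Finite (FreeCk k X) :=
  finite_of_finite_hom (FreeCk k X)

theorem card_eq :
    Nat.card (FreeCk k X) =
      2 ^ (4 ^ k) ^ Nat.card X * 3 ^ ((3 ^ k) ^ Nat.card X - (2 ^ k) ^ Nat.card X) := by
  rw [card_eq_two_pow_mul_three_pow_card_hom]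
  simp only [card_mpMHom, Nat.card_eq_fintype_card (α := Bool), Fintype.card_bool, Nat.card_prod,
    Nat.card_fin]

end FreeCk

end FreeAlgebra

theorem mainTheorem3 (k n : ℕ) (hk : 0 < k) :
    Finite (FreeCk k (Fin n)) ∧
      (Nat.card (FreeCk k (Fin n)) : ℝ) =
        (∏ d ∈ k.divisors, ((2 : ℝ) ^ d) ^ (alpha2 n d : ℝ)) *
        (∏ d ∈ k.divisors, ((3 : ℝ) ^ d) ^ (alpha3 n d : ℝ)) *
        (∏ d ∈ k.divisors, ((4 : ℝ) ^ d) ^ (alpha4 n d : ℝ)) := by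
  have : NeZero k := ⟨hk.ne'⟩
  refine ⟨inferInstance, ?_⟩
  rw [FreeCk.card_eq, Nat.card_fin, prod_pow_rpow_eq_rpow_sum two_pos,
    prod_pow_rpow_eq_rpow_sum three_pos, prod_pow_rpow_eq_rpow_sum four_pos,
    sum_mul_alpha2 n hk, sum_mul_alpha3 n hk, sum_mul_alpha4 n hk]
  simp only [Rat.cast_sub, Rat.cast_div, Rat.cast_pow, Rat.cast_ofNat]
  have hle : (2 ^ k) ^ n ≤ (3 ^ k) ^ n := by gcongr; norm_num
  have hthree : (3 : ℝ) ^ ((3 ^ k) ^ n - (2 ^ k) ^ n : ℝ) = 3 ^ ((3 ^ k) ^ n - (2 ^ k) ^ n) := by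
    exact_mod_cast Real.rpow_natCast 3 ((3 ^ k) ^ n - (2 ^ k) ^ n)
  have htwo : (2 : ℝ) ^ ((2 ^ k) ^ n : ℝ) * 2 ^ ((4 ^ k) ^ n - (2 ^ k) ^ n : ℝ) =
      2 ^ (4 ^ k) ^ n := by
    rw [← Real.rpow_add two_pos, add_sub_cancel]
    exact_mod_cast Real.rpow_natCast 2 ((4 ^ k) ^ n)
  rw [four_rpow_half, hthree, mul_right_comm, htwo]
  norm_cast
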